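/- Let $X=(X_t)_{t\ge 0}$ be a real-valued Lévy process (started at $0$, with stationary and independent increments and almost surely càdlàg paths) with characteristic triplet $(a,\sigma,\nu)$, that is, $\nu$ is a Lévy measure and $$\mathbb E[e^{izX_1}]=\exp\Big(iaz-\tfrac{\sigma^2z^2}{2}+\int_{\mathbb R}\big(e^{izx}-1-izx\,\mathbf 1_{\{|x|\le 1\}}\big)\,\nu(dx)\Big),\qquad z\in\mathbb R.$$ Assume that $\mathbb E[e^{X_t}]<\infty$ for all $t\ge 0$ and that $\sigma>0$, and set $f(t,k)=\mathbb E[(e^{X_t}-k)^+]$, where $(x)^+=\max\{x,0\}$. Then for every $t>0$ the random variable $X_t$ has a (unique) continuous density $p_t$ with respect to Lebesgue measure, and for all $t>0$ and $k>0$ the function $f(t,\cdot)$ is twice differentiable at $k$ with $$\frac{\partial f(t,k)}{\partial k}=-\mathbb P(e^{X_t}>k)\qquad\text{and}\qquad \frac{\partial^2 f(t,k)}{\partial k^2}=\frac{p_t(\log k)}{k}.$$ Moreover, for every fixed $k>0$, both $\frac{\partial f(t,k)}{\partial k}$ and $\frac{\partial^2 f(t,k)}{\partial k^2}$ are continuous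 functions of $t\in(0,\infty)$. -/

import Mathlib

open MeasureTheory ProbabilityTheory Filter Topology
open scoped NNReal ENNReal

noncomputable section

/-- A real-valued Lévy process `X = (X_t)_{t ≥ 0}` on a probability space `(Ω, P)`: it starts at `0`
almost surely, has independent and stationary increments, and almost surely has càdlàg paths. -/
structure IsLevyProcess {Ω : Type*} [MeasurableSpace Ω] (X : ℝ≥0 → Ω → ℝ) (P : Measure Ω) :
    Prop where
  measurable : ∀ t, Measurable (X t)
  zero : ∀ᵐ ω ∂P, X 0 ω = 0
  indep_increments : HasIndepIncrements X P
  stationary_increments : ∀ s t : ℝ≥0, s ≤ t →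
    IdentDistrib (fun ω => X t ω - X s ω) (X (t - s)) P P
  cadlag : ∀ᵐ ω ∂P, ∀ t : ℝ≥0,
    ContinuousWithinAt (fun s => X s ω) (Set.Ici t) t ∧
      ∃ l : ℝ, Tendsto (fun s => X s ω) (𝓝[<] t) (𝓝 l)

/-- `ν` is a Lévy measure on `ℝ`: `ν({0}) = 0` and `∫ min(1, x²) ν(dx) < ∞`. -/
structure IsLevyMeasure (ν : Measure ℝ) : Prop where
  zero : ν {0} = 0
  lintegral_lt_top : ∫⁻ x, ENNReal.ofReal (min 1 (x ^ 2)) ∂ν < ∞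

/-- The Lévy–Khintchine exponent with drift `a`, Gaussian coefficient `σ` and Lévy measure `ν`,
`Ψ(z) = i a z - σ² z² / 2 + ∫ (e^{izx} - 1 - i z x 1_{|x| ≤ 1}) ν(dx)`. -/
def levyKhintchineExponent (a σ : ℝ) (ν : Measure ℝ) (z : ℝ) : ℂ :=
  Complex.I * a * z - (σ : ℂ) ^ 2 * (z : ℂ) ^ 2 / 2 +
    ∫ x : ℝ, (Complex.exp (Complex.I * z * x) - 1 -
      (if |x| ≤ 1 then Complex.I * z * x else 0)) ∂ν

/-- The process `X` has characteristic triplet `(a, σ, ν)`: `ν` is a Lévy measure, `0 ≤ σ`, and the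
characteristic function of `X_1` is the exponential of the Lévy–Khintchine exponent. -/
structure HasLevyTriplet {Ω : Type*} [MeasurableSpace Ω] (X : ℝ≥0 → Ω → ℝ) (P : Measure Ω)
    (a σ : ℝ) (ν : Measure ℝ) : Prop where
  isLevyMeasure : IsLevyMeasure ν
  nonneg : 0 ≤ σ
  charFun_eq : ∀ z : ℝ, charFun (P.map (X 1)) z = Complex.exp (levyKhintchineExponent a σ ν z)

/-- `X` has a first exponential moment: `E[e^{X_t}] < ∞` for all `t ≥ 0`. -/
def HasFirstExpMoment {Ω : Type*} [MeasurableSpace Ω] (X : ℝ≥0 → Ω → ℝ) (P : Measure Ω) : Prop :=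
  ∀ t : ℝ≥0, Integrable (fun ω => Real.exp (X t ω)) P

/-- `f(t, k) = E[(e^{X_t} - k)^+]`. -/
def callFunction {Ω : Type*} [MeasurableSpace Ω] (X : ℝ≥0 → Ω → ℝ) (P : Measure Ω)
    (t : ℝ≥0) (k : ℝ) : ℝ :=
  ∫ ω, max (Real.exp (X t ω) - k) 0 ∂P

/-- `p` is a continuous density of `μ` with respect to Lebesgue measure. There is at most one. -/
structure IsContinuousDensity (p : ℝ → ℝ) (μ : Measure ℝ) : Prop where
  continuous : Continuous p
  nonneg : ∀ x, 0 ≤ p x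
  eq_withDensity : μ = volume.withDensity (fun x => ENNReal.ofReal (p x))

end

/-! The characteristic functions of `X_t` form a continuous multiplicative semigroup in `t`, so that
`|E[e^{izX_t}]| = |E[e^{izX_1}]|^t ≤ exp (-t σ² z² / 2)`, the jump part of the exponent having
nonpositive real part. For `t > 0` this Gaussian bound makes the characteristic function integrable:
Fourier inversion gives the continuous density, which depends continuously on `t` by dominated
convergence, and Lévy's continuity theorem gives the continuity in `t` of the tail `P(e^{X_t} > k)`.
The derivative of `k ↦ (S - k)^+` is `-1_{S > k}` off the null event `S = k`, so the first
derivative of `E[(S - k)^+]` is minus the tail of `S`, and differentiating the tail gives the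
second one. -/

section Measure

variable {α : Type*} [MeasurableSpace α] {m : Measure α}

lemma integral_withDensity_ofReal {q : α → ℝ} (hq : Measurable q) (g : α → ℝ) :
    ∫ x, g x ∂(m.withDensity fun x => ENNReal.ofReal (q x)) = ∫ x, max (q x) 0 * g x ∂m := by
  rw [integral_withDensity_eq_integral_toReal_smul hq.ennreal_ofReal
    (Eventually.of_forall fun _ => ENNReal.ofReal_lt_top)]
  simp only [ENNReal.toReal_ofReal', smul_eq_mul]

variable [TopologicalSpace α] {μ ν : Measure α}

lemma isLocallyFiniteMeasure_add [IsLocallyFiniteMeasure μ] [IsLocallyFiniteMeasure ν] :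
    IsLocallyFiniteMeasure (μ + ν) := by
  refine ⟨fun x => ?_⟩
  obtain ⟨s, hs, hμs⟩ := μ.finiteAt_nhds x
  obtain ⟨t, ht, hνt⟩ := ν.finiteAt_nhds x
  refine ⟨s ∩ t, inter_mem hs ht, ?_⟩
  rw [Measure.add_apply]
  exact ENNReal.add_lt_top.2 ⟨(measure_mono Set.inter_subset_left).trans_lt hμs,
    (measure_mono Set.inter_subset_right).trans_lt hνt⟩

lemma locallyIntegrable_toReal_rnDeriv [LocallyCompactSpace α] [IsLocallyFiniteMeasure μ] :
    LocallyIntegrable (fun x => (μ.rnDeriv m x).toReal) m :=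
  locallyIntegrable_iff.2 fun _ hK => integrable_toReal_of_lintegral_ne_top
    (Measure.measurable_rnDeriv _ _).aemeasurable
    ((Measure.setLIntegral_rnDeriv_le _).trans_lt hK.measure_lt_top).ne

end Measure

section SmoothTestFunctions

open scoped ContDiff

variable {E : Type*} [NormedAddCommGroup E] [NormedSpace ℝ E] [FiniteDimensional ℝ E]
  [MeasurableSpace E] [BorelSpace E]

-- Both measures have a locally integrable density with respect to their sum, so that the
-- uniqueness of densities among locally integrable functions applies.
lemma measure_ext_of_integral_contDiff {μ ν : Measure E} [IsLocallyFiniteMeasure μ]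
    [IsLocallyFiniteMeasure ν]
    (h : ∀ g : E → ℝ, ContDiff ℝ ∞ g → HasCompactSupport g → ∫ x, g x ∂μ = ∫ x, g x ∂ν) :
    μ = ν := by
  have hμ : μ ≪ μ + ν := Measure.absolutelyContinuous_of_le (Measure.le_add_right le_rfl)
  have hν : ν ≪ μ + ν := Measure.absolutelyContinuous_of_le (Measure.le_add_left le_rfl)
  have h_ae : ∀ᵐ x ∂(μ + ν),
      (μ.rnDeriv (μ + ν) x).toReal = (ν.rnDeriv (μ + ν) x).toReal := by
    refine ae_eq_of_integral_contDiff_smul_eq locallyIntegrable_toReal_rnDeriv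
      locallyIntegrable_toReal_rnDeriv fun g hg hgc => ?_
    simp_rw [smul_eq_mul, mul_comm (g _), ← smul_eq_mul]
    rw [integral_rnDeriv_smul hμ, integral_rnDeriv_smul hν, h g hg hgc]
  calc μ = (μ + ν).withDensity (μ.rnDeriv (μ + ν)) :=
        (Measure.withDensity_rnDeriv_eq _ _ hμ).symm
    _ = (μ + ν).withDensity (ν.rnDeriv (μ + ν)) := by
        refine withDensity_congr_ae ?_
        filter_upwards [h_ae, Measure.rnDeriv_lt_top μ (μ + ν), Measure.rnDeriv_lt_top ν (μ + ν)]
          with x hx hμx hνx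
        exact (ENNReal.toReal_eq_toReal_iff' hμx.ne hνx.ne).1 hx
    _ = ν := Measure.withDensity_rnDeriv_eq _ _ hν

variable {m : Measure E} [IsLocallyFiniteMeasure m] {q : E → ℝ} {μ : Measure E}
  [IsLocallyFiniteMeasure μ]

lemma add_withDensity_neg_eq_withDensity (hq : Continuous q)
    (h : ∀ g : E → ℝ, ContDiff ℝ ∞ g → HasCompactSupport g →
      ∫ x, g x ∂μ = ∫ x, q x * g x ∂m) :
    μ + m.withDensity (fun x => ENNReal.ofReal (-q x)) =
      m.withDensity fun x => ENNReal.ofReal (q x) := by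
  have hq_neg : Continuous fun x => -q x := hq.neg
  have := IsLocallyFiniteMeasure.withDensity_ofReal (μ := m) hq
  have := IsLocallyFiniteMeasure.withDensity_ofReal (μ := m) hq_neg
  have := isLocallyFiniteMeasure_add (μ := μ)
    (ν := m.withDensity fun x => ENNReal.ofReal (-q x))
  refine measure_ext_of_integral_contDiff fun g hg hgc => ?_
  have h_int {f : E → ℝ} (hf : Continuous f) : Integrable (fun x => f x * g x) m :=
    (hf.mul hg.continuous).integrable_of_hasCompactSupport hgc.mul_left
  calc ∫ x, g x ∂(μ + m.withDensity fun x => ENNReal.ofReal (-q x))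
      = ∫ x, q x * g x ∂m + ∫ x, max (-q x) 0 * g x ∂m := by
        rw [integral_add_measure (hg.continuous.integrable_of_hasCompactSupport hgc)
          (hg.continuous.integrable_of_hasCompactSupport hgc), h g hg hgc,
          integral_withDensity_ofReal hq_neg.measurable]
    _ = ∫ x, q x * g x + max (-q x) 0 * g x ∂m :=
        (integral_add (h_int hq) (h_int (hq_neg.max continuous_const))).symm
    _ = ∫ x, max (q x) 0 * g x ∂m := by
        refine integral_congr_ae (Eventually.of_forall fun x => ?_)
        rcases le_total 0 (q x) with hx | hx <;> simp [hx]
    _ = ∫ x, g x ∂(m.withDensity fun x => ENNReal.ofReal (q x)) :=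
        (integral_withDensity_ofReal hq.measurable g).symm

variable [m.IsOpenPosMeasure]

lemma nonneg_of_integral_contDiff_eq (hq : Continuous q)
    (h : ∀ g : E → ℝ, ContDiff ℝ ∞ g → HasCompactSupport g →
      ∫ x, g x ∂μ = ∫ x, q x * g x ∂m) (x : E) : 0 ≤ q x := by
  have h_le : m.withDensity (fun x => ENNReal.ofReal (-q x)) ≤
      m.withDensity fun x => ENNReal.ofReal (q x) :=
    (Measure.le_add_left le_rfl).trans_eq (add_withDensity_neg_eq_withDensity hq h)
  have h_ae : ∀ᵐ x ∂m, ENNReal.ofReal (-q x) ≤ ENNReal.ofReal (q x) := by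
    refine ae_le_of_forall_setLIntegral_le_of_sigmaFinite hq.neg.measurable.ennreal_ofReal
      fun s hs _ => ?_
    simpa only [withDensity_apply _ hs] using h_le s
  have h_max : q = fun x => max (q x) 0 := by
    refine Measure.eq_of_ae_eq (μ := m) ?_ hq (hq.max continuous_const)
    filter_upwards [h_ae] with x hx
    refine (max_eq_left ?_).symm
    rcases ENNReal.ofReal_le_ofReal_iff'.1 hx with hx | hx <;> linarith
  rw [h_max]
  exact le_max_right _ _

lemma eq_withDensity_of_integral_contDiff_eq (hq : Continuous q)
    (h : ∀ g : E → ℝ, ContDiff ℝ ∞ g → HasCompactSupport g →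
      ∫ x, g x ∂μ = ∫ x, q x * g x ∂m) :
    μ = m.withDensity fun x => ENNReal.ofReal (q x) := by
  have h_neg (x : E) : ENNReal.ofReal (-q x) = 0 :=
    ENNReal.ofReal_of_nonpos (neg_nonpos.2 (nonneg_of_integral_contDiff_eq hq h x))
  simpa [h_neg] using add_withDensity_neg_eq_withDensity hq h

end SmoothTestFunctions

section FourierInversion

open scoped ContDiff FourierTransform

variable {E : Type*} [NormedAddCommGroup E] [InnerProductSpace ℝ E] [MeasurableSpace E]

/-- The Fourier transform `ξ ↦ ∫ e^{-2πi⟪x, ξ⟫} μ(dx)` of a measure, that is, its characteristic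
function in the normalisation of Mathlib's Fourier transform of functions. -/
noncomputable def measureFourier (μ : Measure E) (ξ : E) : ℂ :=
  charFun μ (-(2 * Real.pi) • ξ)

lemma measureFourier_eq_fourierIntegral (μ : Measure E) :
    measureFourier μ =
      VectorFourier.fourierIntegral Real.fourierChar μ (innerₗ E) (fun _ => (1 : ℂ)) := by
  funext ξ
  rw [measureFourier, charFun_eq_fourierIntegral', smul_smul,
    show -(2 * Real.pi)⁻¹ * -(2 * Real.pi) = 1 by field_simp, one_smul]
  rfl

variable [BorelSpace E] [FiniteDimensional ℝ E]

/-- The real part of the inverse Fourier transform of a measure: for an integrable characteristic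
function it is the density of the measure, and its imaginary part vanishes. -/
noncomputable def charFunDensity (μ : Measure E) (x : E) : ℝ :=
  (𝓕⁻ (measureFourier μ) x).re

variable {μ : Measure E}

lemma integrable_measureFourier (h : Integrable (charFun μ)) : Integrable (measureFourier μ) :=
  h.comp_smul (neg_ne_zero.2 Real.two_pi_pos.ne')

lemma continuous_fourierInv {f : E → ℂ} (hf : Integrable f) : Continuous (𝓕⁻ f) :=
  VectorFourier.fourierIntegral_continuous Real.continuous_fourierChar
    (L := -innerₗ E) continuous_inner.neg hf

lemma continuous_charFunDensity (h : Integrable (charFun μ)) : Continuous (charFunDensity μ) :=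
  Complex.continuous_re.comp (continuous_fourierInv (integrable_measureFourier h))

lemma tendsto_charFunDensity_of_dominated {ι : Type*} {l : Filter ι} [l.IsCountablyGenerated]
    {μs : ι → Measure E} [∀ i, SFinite (μs i)] {bound : E → ℝ} (h_bound : Integrable bound)
    (h_le : ∀ᶠ i in l, ∀ ξ, ‖charFun (μs i) ξ‖ ≤ bound ξ)
    (h_lim : ∀ ξ, Tendsto (fun i => charFun (μs i) ξ) l (𝓝 (charFun μ ξ))) (x : E) :
    Tendsto (fun i => charFunDensity (μs i) x) l (𝓝 (charFunDensity μ x)) := by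
  refine (Complex.continuous_re.tendsto _).comp ?_
  simp only [Real.fourierInv_eq']
  refine tendsto_integral_filter_of_dominated_convergence (fun ξ => bound (-(2 * Real.pi) • ξ))
    (Eventually.of_forall fun i => ?_) ?_
    (h_bound.comp_smul (neg_ne_zero.2 Real.two_pi_pos.ne'))
    (Eventually.of_forall fun ξ => (h_lim _).const_smul _)
  · have h_meas : Measurable (measureFourier (μs i)) := measurable_charFun.comp (by fun_prop)
    exact Measurable.aestronglyMeasurable (by fun_prop)
  · filter_upwards [h_le] with i hi
    refine Eventually.of_forall fun ξ => ?_
    rw [norm_smul, Complex.norm_exp_ofReal_mul_I, one_mul]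
    exact hi _

variable [IsFiniteMeasure μ]

lemma integral_fourier_eq_integral_mul_measureFourier {f : E → ℂ} (hf : Integrable f) :
    ∫ x, 𝓕 f x ∂μ = ∫ ξ, f ξ * measureFourier μ ξ := by
  have h_flip := VectorFourier.integral_fourierIntegral_smul_eq_flip (L := innerₗ E) (ν := μ)
    (g := fun _ => (1 : ℂ)) Real.continuous_fourierChar continuous_inner hf (integrable_const _)
  rw [flip_innerₗ, ← measureFourier_eq_fourierIntegral] at h_flip
  simp only [smul_eq_mul, mul_one] at h_flip
  exact h_flip

lemma integral_fourierInv_mul_eq {f g : E → ℂ} (hf : Integrable f) (hg : Integrable g) :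
    ∫ ξ, 𝓕⁻ f ξ * g ξ = ∫ x, f x * 𝓕⁻ g x := by
  have h_flip := VectorFourier.integral_fourierIntegral_smul_eq_flip (L := -innerₗ E)
    Real.continuous_fourierChar continuous_inner.neg hf hg
  have h_symm : (-innerₗ E).flip = -innerₗ E := by
    ext x y
    simp [real_inner_comm]
  rw [h_symm] at h_flip
  exact h_flip

lemma integral_schwartz_eq_integral_mul_fourierInv (h : Integrable (charFun μ))
    (g : SchwartzMap E ℂ) :
    ∫ x, g x ∂μ = ∫ x, g x * 𝓕⁻ (measureFourier μ) x := by
  calc ∫ x, g x ∂μ = ∫ x, 𝓕 ⇑(𝓕⁻ g : SchwartzMap E ℂ) x ∂μ := by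
        rw [← SchwartzMap.fourier_coe, FourierTransform.fourier_fourierInv_eq]
    _ = ∫ ξ, 𝓕⁻ ⇑g ξ * measureFourier μ ξ := by
        rw [integral_fourier_eq_integral_mul_measureFourier (𝓕⁻ g : SchwartzMap E ℂ).integrable,
          SchwartzMap.fourierInv_coe]
    _ = ∫ x, g x * 𝓕⁻ (measureFourier μ) x :=
        integral_fourierInv_mul_eq g.integrable (integrable_measureFourier h)

lemma integral_contDiff_eq_integral_charFunDensity_mul (h : Integrable (charFun μ)) {g : E → ℝ}
    (hg : ContDiff ℝ ∞ g) (hgc : HasCompactSupport g) :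
    ∫ x, g x ∂μ = ∫ x, charFunDensity μ x * g x := by
  have hg' : ContDiff ℝ ∞ (fun x => (g x : ℂ)) := Complex.ofRealCLM.contDiff.comp hg
  have hgc' : HasCompactSupport (fun x => (g x : ℂ)) := hgc.comp_left Complex.ofReal_zero
  have h_int : Integrable fun x => (g x : ℂ) * 𝓕⁻ (measureFourier μ) x :=
    (hg'.continuous.mul (continuous_fourierInv (integrable_measureFourier h)))
      |>.integrable_of_hasCompactSupport hgc'.mul_right
  calc ∫ x, g x ∂μ = (∫ x, (g x : ℂ) ∂μ).re := by
        rw [integral_complex_ofReal, Complex.ofReal_re]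
    _ = (∫ x, (g x : ℂ) * 𝓕⁻ (measureFourier μ) x).re :=
        congrArg Complex.re
          (integral_schwartz_eq_integral_mul_fourierInv h (hgc'.toSchwartzMap hg'))
    _ = ∫ x, ((g x : ℂ) * 𝓕⁻ (measureFourier μ) x).re := (integral_re h_int).symm
    _ = ∫ x, charFunDensity μ x * g x := by
        simp only [Complex.re_ofReal_mul, charFunDensity, mul_comm]

lemma charFunDensity_nonneg (h : Integrable (charFun μ)) (x : E) : 0 ≤ charFunDensity μ x :=
  nonneg_of_integral_contDiff_eq (continuous_charFunDensity h)
    (fun _ => integral_contDiff_eq_integral_charFunDensity_mul h) x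

theorem eq_withDensity_charFunDensity (h : Integrable (charFun μ)) :
    μ = volume.withDensity fun x => ENNReal.ofReal (charFunDensity μ x) :=
  eq_withDensity_of_integral_contDiff_eq (continuous_charFunDensity h)
    fun _ => integral_contDiff_eq_integral_charFunDensity_mul h

end FourierInversion
section AddChar

lemma norm_addChar_sub_le {R : Type*} [NormedRing R] {ψ : AddChar ℝ≥0 R}
    (h_le : ∀ t, ‖ψ t‖ ≤ 1) (s t : ℝ≥0) : ‖ψ s - ψ t‖ ≤ ‖ψ (nndist s t) - 1‖ := by
  wlog hst : s ≤ t generalizing s t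
  · rw [norm_sub_rev, nndist_comm]
    exact this t s (le_of_not_ge hst)
  have h_dist : t = s + nndist s t := by
    rw [NNReal.nndist_eq, tsub_eq_zero_of_le hst, max_eq_right zero_le, add_tsub_cancel_of_le hst]
  calc ‖ψ s - ψ t‖ = ‖ψ s * (ψ (nndist s t) - 1)‖ := by
        conv_lhs => rw [h_dist, ψ.map_add_eq_mul, norm_sub_rev, ← mul_sub_one]
    _ ≤ ‖ψ s‖ * ‖ψ (nndist s t) - 1‖ := norm_mul_le _ _
    _ ≤ ‖ψ (nndist s t) - 1‖ := mul_le_of_le_one_left (norm_nonneg _) (h_le s)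

lemma continuous_addChar_of_continuousAt_zero {R : Type*} [NormedRing R] {ψ : AddChar ℝ≥0 R}
    (h_le : ∀ t, ‖ψ t‖ ≤ 1) (h_zero : ContinuousAt ψ 0) : Continuous ψ := by
  refine continuous_iff_continuousAt.2 fun t => tendsto_iff_norm_sub_tendsto_zero.2 ?_
  have h_dist : Tendsto (fun s => nndist s t) (𝓝 t) (𝓝 0) := by
    simpa using (continuous_id.nndist (continuous_const (y := t))).tendsto t
  have h_norm : Tendsto (fun s => ‖ψ (nndist s t) - 1‖) (𝓝 t) (𝓝 0) := by
    simpa using ((h_zero.tendsto.comp h_dist).sub_const 1).norm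
  exact squeeze_zero (fun _ => norm_nonneg _) (fun s => norm_addChar_sub_le h_le s t) h_norm

lemma denseRange_nnratCast_nnreal : DenseRange ((↑) : ℚ≥0 → ℝ≥0) := by
  refine dense_of_exists_between fun a b hab => ?_
  obtain ⟨q, hq, haq, hqb⟩ := (NNReal.lt_iff_exists_rat_btwn a b).1 hab
  lift q to ℚ≥0 using hq
  have h_cast : Real.toNNReal ((q : ℚ) : ℝ) = (q : ℝ≥0) := by
    rw [show ((q : ℚ) : ℝ) = ((q : ℝ≥0) : ℝ) by norm_cast, Real.toNNReal_coe]
  exact ⟨q, ⟨q, rfl⟩, h_cast ▸ haq, h_cast ▸ hqb⟩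

lemma addChar_eq_rpow {ψ : AddChar ℝ≥0 ℝ} (hψ : Continuous ψ) (h_one : ψ 1 ≠ 0) (t : ℝ≥0) :
    ψ t = ψ 1 ^ (t : ℝ) := by
  have h_nonneg (s : ℝ≥0) : 0 ≤ ψ s := by
    rw [← add_halves s, ψ.map_add_eq_mul]
    exact mul_self_nonneg _
  refine denseRange_nnratCast_nnreal.induction_on t
    (isClosed_eq hψ ((Real.continuous_const_rpow h_one).comp NNReal.continuous_coe)) fun q => ?_
  have h_pow : ψ q ^ q.den = ψ 1 ^ q.num := by
    rw [← ψ.map_nsmul_eq_pow, ← ψ.map_nsmul_eq_pow, nsmul_eq_mul, nsmul_eq_mul, mul_one]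
    congr 1
    exact_mod_cast q.den_mul_eq_num
  refine (pow_left_inj₀ (h_nonneg _) (Real.rpow_nonneg (h_nonneg 1) _) q.den_ne_zero).1 ?_
  rw [h_pow, ← Real.rpow_mul_natCast (h_nonneg 1), ← Real.rpow_natCast]
  congr 1
  exact_mod_cast q.mul_den_eq_num.symm

end AddChar

section CharFun

variable {E : Type*} [NormedAddCommGroup E] [InnerProductSpace ℝ E] [MeasurableSpace E]
  [BorelSpace E] {ι : Type*} {l : Filter ι} [l.IsCountablyGenerated]

lemma tendsto_charFun_map_of_ae_tendsto {Ω : Type*} [MeasurableSpace Ω] {P : Measure Ω}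
    [IsFiniteMeasure P] {Y : ι → Ω → E} {Z : Ω → E} (hY : ∀ i, AEMeasurable (Y i) P)
    (hZ : AEMeasurable Z P) (h : ∀ᵐ ω ∂P, Tendsto (fun i => Y i ω) l (𝓝 (Z ω))) (z : E) :
    Tendsto (fun i => charFun (P.map (Y i)) z) l (𝓝 (charFun (P.map Z) z)) := by
  have h_cont : Continuous fun x : E => Complex.exp (inner ℝ x z * Complex.I) := by fun_prop
  have h_map {W : Ω → E} (hW : AEMeasurable W P) :
      charFun (P.map W) z = ∫ ω, Complex.exp (inner ℝ (W ω) z * Complex.I) ∂P := by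
    rw [charFun_apply, integral_map hW h_cont.aestronglyMeasurable]
  simp only [h_map (hY _), h_map hZ]
  refine tendsto_integral_filter_of_dominated_convergence (fun _ => 1)
    (Eventually.of_forall fun i => (h_cont.measurable.comp_aemeasurable
      (hY i)).aestronglyMeasurable) ?_ (integrable_const _) ?_
  · exact Eventually.of_forall fun i => Eventually.of_forall fun ω =>
      (Complex.norm_exp_ofReal_mul_I _).le
  · filter_upwards [h] with ω hω
    exact (h_cont.tendsto _).comp hω

lemma tendsto_measureReal_of_tendsto_charFun [FiniteDimensional ℝ E] {μs : ι → Measure E}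
    {μ : Measure E} [∀ i, IsProbabilityMeasure (μs i)] [IsProbabilityMeasure μ]
    (h : ∀ z, Tendsto (fun i => charFun (μs i) z) l (𝓝 (charFun μ z))) {s : Set E}
    (hs : μ (frontier s) = 0) :
    Tendsto (fun i => (μs i).real s) l (𝓝 (μ.real s)) := by
  refine tendsto_of_seq_tendsto fun u hu => ?_
  let M (n : ℕ) : ProbabilityMeasure E := ⟨μs (u n), inferInstance⟩
  have h_weak : Tendsto M atTop (𝓝 ⟨μ, inferInstance⟩) :=
    ProbabilityMeasure.tendsto_of_tendsto_charFun fun z => (h z).comp hu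
  exact (ENNReal.tendsto_toReal (measure_ne_top _ _)).comp
    (ProbabilityMeasure.tendsto_measure_of_null_frontier_of_tendsto' h_weak hs)

end CharFun

section LevyKhintchine

lemma re_integral_nonpos {α 𝕜 : Type*} [MeasurableSpace α] {m : Measure α} [RCLike 𝕜]
    {f : α → 𝕜} (hf : ∀ x, RCLike.re (f x) ≤ 0) : RCLike.re (∫ x, f x ∂m) ≤ 0 := by
  by_cases h_int : Integrable f m
  · rw [← integral_re h_int]
    exact integral_nonpos hf
  · rw [integral_undef h_int, map_zero]

lemma levyKhintchineExponent_re_le (a σ : ℝ) (ν : Measure ℝ) (z : ℝ) :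
    (levyKhintchineExponent a σ ν z).re ≤ -(σ ^ 2 / 2) * z ^ 2 := by
  have h_drift : (Complex.I * a * z).re = 0 := by simp
  have h_gauss : ((σ : ℂ) ^ 2 * (z : ℂ) ^ 2 / 2).re = σ ^ 2 / 2 * z ^ 2 := by
    rw [show (σ : ℂ) ^ 2 * (z : ℂ) ^ 2 / 2 = ((σ ^ 2 / 2 * z ^ 2 : ℝ) : ℂ) by push_cast; ring,
      Complex.ofReal_re]
  have h_jump : (∫ x : ℝ, (Complex.exp (Complex.I * z * x) - 1 -
      (if |x| ≤ 1 then Complex.I * z * x else 0)) ∂ν).re ≤ 0 := by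
    refine re_integral_nonpos (𝕜 := ℂ) fun x => ?_
    have h_exp : (Complex.exp (Complex.I * z * x)).re = Real.cos (z * x) := by
      rw [show Complex.I * z * x = ((z * x : ℝ) : ℂ) * Complex.I by push_cast; ring,
        Complex.exp_ofReal_mul_I_re]
    have h_comp : (if |x| ≤ 1 then Complex.I * z * x else 0 : ℂ).re = 0 := by
      split_ifs <;> simp
    rw [RCLike.re_to_complex, Complex.sub_re, Complex.sub_re, h_exp, h_comp, Complex.one_re]
    linarith [Real.cos_le_one (z * x)]
  rw [levyKhintchineExponent, Complex.add_re, Complex.sub_re, h_drift, h_gauss]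
  linarith

lemma HasLevyTriplet.norm_charFun_one_le {Ω : Type*} [MeasurableSpace Ω] {P : Measure Ω}
    {X : ℝ≥0 → Ω → ℝ} {a σ : ℝ} {ν : Measure ℝ} (h : HasLevyTriplet X P a σ ν) (z : ℝ) :
    ‖charFun (P.map (X 1)) z‖ ≤ Real.exp (-(σ ^ 2 / 2) * z ^ 2) := by
  rw [h.charFun_eq, Complex.norm_exp]
  exact Real.exp_le_exp.2 (levyKhintchineExponent_re_le a σ ν z)

end LevyKhintchine

namespace IsLevyProcess

variable {Ω : Type*} [MeasurableSpace Ω] {P : Measure Ω} [IsProbabilityMeasure P]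
  {X : ℝ≥0 → Ω → ℝ}

lemma isProbabilityMeasure_map (hX : IsLevyProcess X P) (t : ℝ≥0) :
    IsProbabilityMeasure (P.map (X t)) :=
  Measure.isProbabilityMeasure_map (hX.measurable t).aemeasurable

lemma norm_charFun_le_one (hX : IsLevyProcess X P) (t : ℝ≥0) (z : ℝ) :
    ‖charFun (P.map (X t)) z‖ ≤ 1 :=
  have := hX.isProbabilityMeasure_map t
  MeasureTheory.norm_charFun_le_one z

lemma charFun_zero (hX : IsLevyProcess X P) (z : ℝ) : charFun (P.map (X 0)) z = 1 := by
  rw [Measure.map_congr (show X 0 =ᵐ[P] fun _ => 0 from hX.zero), Measure.map_const]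
  simp

lemma charFun_add (hX : IsLevyProcess X P) (s t : ℝ≥0) (z : ℝ) :
    charFun (P.map (X (s + t))) z = charFun (P.map (X s)) z * charFun (P.map (X t)) z := by
  have h_indep : X s ⟂ᵢ[P] (X (s + t) - X s) :=
    hX.indep_increments.indepFun_eval_sub (zero_le (a := s)) le_self_add hX.zero
  have h_stat : P.map (X (s + t) - X s) = P.map (X t) := by
    have h_map := (hX.stationary_increments s (s + t) le_self_add).map_eq
    rwa [add_tsub_cancel_left] at h_map
  have h_mul := congrFun (h_indep.charFun_map_add_eq_mul (hX.measurable s).aemeasurable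
    ((hX.measurable _).sub (hX.measurable s)).aemeasurable) z
  rwa [add_sub_cancel, h_stat] at h_mul

/-- For fixed `z`, the characteristic functions `t ↦ E[e^{i z X_t}]` as a multiplicative character
of the time semigroup `[0, ∞)`. -/
noncomputable def charFunAddChar (hX : IsLevyProcess X P) (z : ℝ) : AddChar ℝ≥0 ℂ where
  toFun t := charFun (P.map (X t)) z
  map_zero_eq_one' := hX.charFun_zero z
  map_add_eq_mul' s t := hX.charFun_add s t z

lemma continuousAt_charFun_zero (hX : IsLevyProcess X P) (z : ℝ) :
    ContinuousAt (fun t => charFun (P.map (X t)) z) 0 := by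
  refine tendsto_charFun_map_of_ae_tendsto (fun t => (hX.measurable t).aemeasurable)
    (hX.measurable 0).aemeasurable ?_ z
  filter_upwards [hX.cadlag] with ω hω
  have h_right := (hω 0).1
  rwa [show Set.Ici (0 : ℝ≥0) = Set.univ from Set.Ici_bot, continuousWithinAt_univ] at h_right

lemma continuous_charFun (hX : IsLevyProcess X P) (z : ℝ) :
    Continuous fun t => charFun (P.map (X t)) z :=
  continuous_addChar_of_continuousAt_zero (ψ := hX.charFunAddChar z)
    (fun t => hX.norm_charFun_le_one t z) (hX.continuousAt_charFun_zero z)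

lemma norm_charFun_eq_rpow (hX : IsLevyProcess X P) {z : ℝ} (h : charFun (P.map (X 1)) z ≠ 0)
    (t : ℝ≥0) : ‖charFun (P.map (X t)) z‖ = ‖charFun (P.map (X 1)) z‖ ^ (t : ℝ) :=
  addChar_eq_rpow (ψ := (normHom : ℂ →*₀ ℝ).toMonoidHom.compAddChar (hX.charFunAddChar z))
    (hX.continuous_charFun z).norm (norm_ne_zero_iff.2 h) t

lemma continuousAt_measureReal_Ioi (hX : IsLevyProcess X P) {t : ℝ≥0} {x : ℝ}
    (hx : P.map (X t) {x} = 0) :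
    ContinuousAt (fun t => (P.map (X t)).real (Set.Ioi x)) t :=
  have := hX.isProbabilityMeasure_map
  tendsto_measureReal_of_tendsto_charFun (fun z => (hX.continuous_charFun z).tendsto t)
    (by rwa [frontier_Ioi])

variable {a σ : ℝ} {ν : Measure ℝ}

lemma norm_charFun_le_exp (hX : IsLevyProcess X P) (h_triplet : HasLevyTriplet X P a σ ν)
    (t : ℝ≥0) (z : ℝ) :
    ‖charFun (P.map (X t)) z‖ ≤ Real.exp (-(σ ^ 2 / 2 * t) * z ^ 2) := by
  have h_one : charFun (P.map (X 1)) z ≠ 0 := by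
    rw [h_triplet.charFun_eq]
    exact Complex.exp_ne_zero _
  calc ‖charFun (P.map (X t)) z‖ = ‖charFun (P.map (X 1)) z‖ ^ (t : ℝ) :=
        hX.norm_charFun_eq_rpow h_one t
    _ ≤ Real.exp (-(σ ^ 2 / 2) * z ^ 2) ^ (t : ℝ) :=
        Real.rpow_le_rpow (norm_nonneg _) (h_triplet.norm_charFun_one_le z) t.coe_nonneg
    _ = Real.exp (-(σ ^ 2 / 2 * t) * z ^ 2) := by
        rw [← Real.exp_mul]
        ring_nf

lemma integrable_charFun (hX : IsLevyProcess X P) (h_triplet : HasLevyTriplet X P a σ ν)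
    (hσ : σ ≠ 0) {t : ℝ≥0} (ht : 0 < t) : Integrable (charFun (P.map (X t))) :=
  have := hX.isProbabilityMeasure_map t
  (integrable_exp_neg_mul_sq (b := σ ^ 2 / 2 * t) (by positivity)).mono'
    stronglyMeasurable_charFun.aestronglyMeasurable
    (Eventually.of_forall (hX.norm_charFun_le_exp h_triplet t))

theorem isContinuousDensity_charFunDensity (hX : IsLevyProcess X P)
    (h_triplet : HasLevyTriplet X P a σ ν) (hσ : σ ≠ 0) {t : ℝ≥0} (ht : 0 < t) :
    IsContinuousDensity (charFunDensity (P.map (X t))) (P.map (X t)) :=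
  have := hX.isProbabilityMeasure_map t
  have h_int := hX.integrable_charFun h_triplet hσ ht
  ⟨continuous_charFunDensity h_int, charFunDensity_nonneg h_int,
    eq_withDensity_charFunDensity h_int⟩

lemma continuousAt_charFunDensity (hX : IsLevyProcess X P) (h_triplet : HasLevyTriplet X P a σ ν)
    (hσ : σ ≠ 0) {t : ℝ≥0} (ht : 0 < t) (x : ℝ) :
    ContinuousAt (fun t => charFunDensity (P.map (X t)) x) t := by
  have := hX.isProbabilityMeasure_map
  refine tendsto_charFunDensity_of_dominated
    (integrable_exp_neg_mul_sq (b := σ ^ 2 / 2 * (t / 2 : ℝ≥0)) (by positivity)) ?_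
    (fun z => (hX.continuous_charFun z).tendsto t) x
  filter_upwards [lt_mem_nhds (half_lt_self ht)] with s hs z
  refine (hX.norm_charFun_le_exp h_triplet s z).trans ?_
  gcongr

end IsLevyProcess

namespace IsContinuousDensity

variable {μ : Measure ℝ} {p : ℝ → ℝ}

lemma measure_singleton (h : IsContinuousDensity p μ) (x : ℝ) : μ {x} = 0 := by
  rw [h.eq_withDensity]
  exact withDensity_absolutelyContinuous _ _ (Real.volume_singleton)

lemma measureReal_Ioc (h : IsContinuousDensity p μ) {x y : ℝ} (hxy : x ≤ y) :
    μ.real (Set.Ioc x y) = ∫ u in x..y, p u := by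
  rw [measureReal_def, h.eq_withDensity, withDensity_apply _ measurableSet_Ioc,
    intervalIntegral.integral_of_le hxy,
    integral_eq_lintegral_of_nonneg_ae (Eventually.of_forall h.nonneg)
      h.continuous.aestronglyMeasurable]

variable [IsFiniteMeasure μ]

lemma measureReal_Ioi (h : IsContinuousDensity p μ) (x y : ℝ) :
    μ.real (Set.Ioi y) = μ.real (Set.Ioi x) - ∫ u in x..y, p u := by
  wlog hxy : x ≤ y generalizing x y
  · rw [this y x (le_of_not_ge hxy), intervalIntegral.integral_symm]
    ring
  rw [← h.measureReal_Ioc hxy, ← Set.Ioc_union_Ioi_eq_Ioi hxy,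
    measureReal_union (Set.Ioc_disjoint_Ioi le_rfl) measurableSet_Ioi]
  ring

lemma hasDerivAt_measureReal_Ioi (h : IsContinuousDensity p μ) (x : ℝ) :
    HasDerivAt (fun y => μ.real (Set.Ioi y)) (-p x) x := by
  simpa only [← h.measureReal_Ioi x] using
    (h.continuous.integral_hasStrictDerivAt x x).hasDerivAt.const_sub (μ.real (Set.Ioi x))

end IsContinuousDensity

section CallFunction

lemma hasDerivAt_max_sub_zero {s k : ℝ} (h : s ≠ k) :
    HasDerivAt (fun x => max (s - x) 0) (if k < s then -1 else 0) k := by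
  rcases h.lt_or_gt with h_lt | h_gt
  · rw [if_neg h_lt.not_gt]
    refine (hasDerivAt_const k 0).congr_of_eventuallyEq ?_
    filter_upwards [lt_mem_nhds h_lt] with x hx
    exact max_eq_right (sub_nonpos.2 hx.le)
  · rw [if_pos h_gt]
    refine ((hasDerivAt_id k).const_sub s).congr_of_eventuallyEq ?_
    filter_upwards [gt_mem_nhds h_gt] with x hx
    exact max_eq_left (sub_nonneg.2 hx.le)

lemma lipschitzWith_max_sub_zero (s : ℝ) : LipschitzWith 1 fun x => max (s - x) 0 :=
  (IsometryEquiv.subLeft s).isometry.lipschitz.max_const 0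

variable {Ω : Type*} [MeasurableSpace Ω] {P : Measure Ω}

lemma measureReal_lt_exp {Y : Ω → ℝ} (hY : AEMeasurable Y P) {k : ℝ} (hk : 0 < k) :
    P.real {ω | k < Real.exp (Y ω)} = (P.map Y).real (Set.Ioi (Real.log k)) := by
  rw [measureReal_def, measureReal_def, Measure.map_apply_of_aemeasurable hY measurableSet_Ioi]
  simp only [Set.preimage, Set.mem_Ioi, Real.log_lt_iff_lt_exp hk]

variable [IsFiniteMeasure P]

lemma hasDerivAt_integral_max_sub_zero {S : Ω → ℝ} (hS : Integrable S P) {k : ℝ}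
    (hk : ∀ᵐ ω ∂P, S ω ≠ k) :
    HasDerivAt (fun x => ∫ ω, max (S ω - x) 0 ∂P) (-(P.real {ω | k < S ω})) k := by
  have h_set : NullMeasurableSet {ω | k < S ω} P :=
    nullMeasurableSet_lt aemeasurable_const hS.aemeasurable
  have h_ind : (fun ω => if k < S ω then (-1 : ℝ) else 0) =
      {ω | k < S ω}.indicator fun _ => -1 := by
    ext ω
    simp [Set.indicator_apply]
  have h_val : ∫ ω, (if k < S ω then -1 else 0) ∂P = -(P.real {ω | k < S ω}) := by
    rw [h_ind, integral_indicator₀ h_set, setIntegral_const, smul_eq_mul, mul_neg_one]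
  rw [← h_val]
  refine (hasDerivAt_integral_of_dominated_loc_of_lip (bound := fun _ => 1) univ_mem
    (Eventually.of_forall fun x => ?_) ?_ ?_ ?_ (integrable_const _) ?_).2
  · exact (hS.sub (integrable_const x)).pos_part.aestronglyMeasurable
  · exact (hS.sub (integrable_const k)).pos_part
  · rw [h_ind]
    exact aestronglyMeasurable_const.indicator₀ h_set
  · refine Eventually.of_forall fun ω => ?_
    rw [map_one]
    exact (lipschitzWith_max_sub_zero (S ω)).lipschitzOnWith
  · filter_upwards [hk] with ω hω
    exact hasDerivAt_max_sub_zero hω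

variable {X : ℝ≥0 → Ω → ℝ} {t : ℝ≥0} {p : ℝ → ℝ}

lemma IsContinuousDensity.hasDerivAt_callFunction (hp : IsContinuousDensity p (P.map (X t)))
    (h_exp : Integrable (fun ω => Real.exp (X t ω)) P) (k : ℝ) :
    HasDerivAt (callFunction X P t) (-(P.real {ω | k < Real.exp (X t ω)})) k := by
  have hX : AEMeasurable (X t) P := Real.aemeasurable_of_aemeasurable_exp h_exp.aemeasurable
  have h_null : P (X t ⁻¹' {Real.log k}) = 0 := by
    rw [← Measure.map_apply_of_aemeasurable hX (measurableSet_singleton _), hp.measure_singleton]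
  refine hasDerivAt_integral_max_sub_zero h_exp ?_
  filter_upwards [measure_eq_zero_iff_ae_notMem.1 h_null] with ω hω h_eq
  exact hω (by rw [Set.mem_preimage, ← h_eq, Real.log_exp, Set.mem_singleton_iff])

lemma IsContinuousDensity.hasDerivAt_deriv_callFunction
    (hp : IsContinuousDensity p (P.map (X t)))
    (h_exp : Integrable (fun ω => Real.exp (X t ω)) P) {k : ℝ} (hk : 0 < k) :
    HasDerivAt (deriv (callFunction X P t)) (p (Real.log k) / k) k := by
  have hX : AEMeasurable (X t) P := Real.aemeasurable_of_aemeasurable_exp h_exp.aemeasurable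
  have h_tail : HasDerivAt (fun x => -(P.map (X t)).real (Set.Ioi (Real.log x)))
      (p (Real.log k) / k) k := by
    have h_comp := ((hp.hasDerivAt_measureReal_Ioi (Real.log k)).comp k
      (Real.hasDerivAt_log hk.ne')).fun_neg
    rwa [neg_mul, neg_neg, ← div_eq_mul_inv] at h_comp
  refine h_tail.congr_of_eventuallyEq ?_
  filter_upwards [lt_mem_nhds hk] with x hx
  rw [(hp.hasDerivAt_callFunction h_exp x).deriv, measureReal_lt_exp hX hx]

end CallFunction

theorem propositionA1 {Ω : Type*} [MeasurableSpace Ω] (P : Measure Ω) [IsProbabilityMeasure P]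
    (X : ℝ≥0 → Ω → ℝ) (hX : IsLevyProcess X P)
    (a σ : ℝ) (ν : Measure ℝ) (htriplet : HasLevyTriplet X P a σ ν)
    (hexp : HasFirstExpMoment X P) (hσ : 0 < σ) :
    ∃ p : ℝ≥0 → ℝ → ℝ,
      (∀ t : ℝ≥0, 0 < t → IsContinuousDensity (p t) (P.map (X t))) ∧
      (∀ t : ℝ≥0, 0 < t → ∀ k : ℝ, 0 < k →
        HasDerivAt (callFunction X P t) (-(P.real {ω | k < Real.exp (X t ω)})) k ∧
        HasDerivAt (deriv (callFunction X P t)) (p t (Real.log k) / k) k) ∧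
      (∀ k : ℝ, 0 < k →
        ContinuousOn (fun t : ℝ≥0 => deriv (callFunction X P t) k) (Set.Ioi 0) ∧
        ContinuousOn (fun t : ℝ≥0 => deriv (deriv (callFunction X P t)) k) (Set.Ioi 0)) := by
  have h_density (t : ℝ≥0) (ht : 0 < t) :
      IsContinuousDensity (charFunDensity (P.map (X t))) (P.map (X t)) :=
    hX.isContinuousDensity_charFunDensity htriplet hσ.ne' ht
  have h_deriv (t : ℝ≥0) (ht : 0 < t) (k : ℝ) :=
    (h_density t ht).hasDerivAt_callFunction (hexp t) k
  have h_deriv₂ (t : ℝ≥0) (ht : 0 < t) (k : ℝ) (hk : 0 < k) :=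
    (h_density t ht).hasDerivAt_deriv_callFunction (hexp t) hk
  refine ⟨fun t => charFunDensity (P.map (X t)), h_density,
    fun t ht k hk => ⟨h_deriv t ht k, h_deriv₂ t ht k hk⟩, fun k hk => ⟨?_, ?_⟩⟩
  · refine ContinuousOn.congr (f := fun t => -(P.map (X t)).real (Set.Ioi (Real.log k)))
      (fun t ht => ?_) fun t ht => ?_
    · exact (hX.continuousAt_measureReal_Ioi
        ((h_density t ht).measure_singleton _)).neg.continuousWithinAt
    · rw [(h_deriv t ht k).deriv, measureReal_lt_exp (hX.measurable t).aemeasurable hk]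
  · refine ContinuousOn.congr (f := fun t => charFunDensity (P.map (X t)) (Real.log k) / k)
      (fun t ht => ?_) fun t ht => (h_deriv₂ t ht k hk).deriv
    exact ((hX.continuousAt_charFunDensity htriplet hσ.ne' ht _).div_const k).continuousWithinAt
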